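/- Let $V\in C^2(\mathbb R^d)$ with $e^{-V}$ integrable and $\nabla^2V\preceq L\,I$, let $\pi\propto e^{-V}$ be the associated probability measure, and write $\langle f,g\rangle_\pi=\int fg\,d\pi$ and $\|\cdot\|$ for the norm of $L^2_\pi$. Let $\mathcal L g=-\Delta g+\langle\nabla V,\nabla g\rangle$ be the Langevin generator; a $C^2$ function $g$ is in its domain if $g,\nabla g,\mathcal Lg\in L^2_\pi$. Assume that $\mathcal L$ has a discrete spectrum $0=\lambda_0<\lambda_1\le\lambda_2\le\cdots$ with a complete $L^2_\pi$-orthonormal system of eigenfunctions $(\phi_i)_{i\ge0}$ of class $C^2$ in the domain, $\phi_0\equiv1$, and let $\Pi_r$ be the orthogonal projection onto $\mathrm{span}\{\phi_1,\dots,\phi_r\}$. Let $\hat\lambda_1,\dots,\hat\lambda_r>0$, let $\hat\phi_1,\dots,\hat\phi_r$ be $C^2$ functions in the domain of $\mathcal L$ with $\int\hat\phi_i\,d\pi=0$, and put $$\widehat{\mathcal K}_rf=\sum_{i=1}^r\frac1{\hat\lambda_i}\langle f,\hat\phi_i\rangle_\pi\hat\phi_i,\qquad \delta_r(f)=\mathcal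 L\widehat{\mathcal K}_rf-\Pi_rf .$$ For a step size $h>0$ and an initial probability measure $\mu_0$ consider the iterates $$\mu_{t+1}=(\mathrm I-h\,\hat v_t)_\#\mu_t,\qquad \hat v_t=\nabla\widehat{\mathcal K}_r\Big(\frac{d\mu_t}{d\pi}\Big),\qquad t=0,1,2,\dots$$ Let $0<\varepsilon_r<1$, $\eta_r>0$ and $B$ be constants such that for every $t\ge0$: $\mu_t\ll\pi$ and $f_t:=\frac{d\mu_t}{d\pi}-1\in L^2_\pi$; $\|(I-\Pi_r)f_t\|\le\eta_r$; $|\langle f_t,\delta_r(f_t)\rangle_\pi|\le\varepsilon_r\|f_t\|^2$; and $\|\hat v_t\|_{L^2(\mu_t)}\le B$ and $\|D\hat v_t(x)\|\le B$ for all $x\in\mathbb R^d$. Put $\alpha=1-\varepsilon_r$ and $\beta=\eta_r^2$. Then there are constants $C\ge0$ and $h_0>0$, depending only on $d$, $L$ and $B$ (in particular not on $h$, $t$, $T$, $\mu_0$, $r$, $\varepsilon_r$ or $\eta_r$), such that, whenever $0<h\le h_0$, all the divergences $\mathrm{KL}(\mu_t\|\pi)$ are finite, for every $t\ge0$ $$\mathrm{KL}(\mu_{t+1}\|\pi)\le(1-\alpha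 h)\,\mathrm{KL}(\mu_t\|\pi)+h\beta+C h^2,$$ and for every $T\ge0$ $$\mathrm{KL}(\mu_T\|\pi)\le(1-\alpha h)^T\,\mathrm{KL}(\mu_0\|\pi)+\frac{\beta}{\alpha}+\frac{C}{\alpha}\,h .$$ -/

import Mathlib

open MeasureTheory

noncomputable section

namespace KSWGD

/-- Euclidean space `ℝᵈ`. -/
abbrev Sp (d : ℕ) : Type := EuclideanSpace ℝ (Fin d)

/-- The probability measure `π ∝ exp (-V)` on `ℝᵈ` (when `exp (-V)` is integrable). -/
def gibbs {d : ℕ} (V : Sp d → ℝ) : Measure (Sp d) :=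
  (volume : Measure (Sp d)).tilted (fun x => -V x)

/-- The inner product `⟨f, g⟩_π` of `L²(π)`, where `π ∝ exp (-V)`. -/
def ip {d : ℕ} (V : Sp d → ℝ) (f g : Sp d → ℝ) : ℝ :=
  ∫ x, f x * g x ∂(gibbs V)

/-- The Langevin generator `ℒ g = -Δ g + ⟨∇V, ∇g⟩`. -/
def langevin {d : ℕ} (V g : Sp d → ℝ) (x : Sp d) : ℝ :=
  -Laplacian.laplacian g x + inner ℝ (gradient V x) (gradient g x)

/-- `g` is a twice continuously differentiable element of the domain of `ℒ` in `L²(π)`: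
`g`, `∇g` and `ℒ g` are all square integrable with respect to `π`. -/
structure InDomain {d : ℕ} (V g : Sp d → ℝ) : Prop where
  contDiff : ContDiff ℝ 2 g
  memLp : MemLp g 2 (gibbs V)
  grad_memLp : MemLp (gradient g) 2 (gibbs V)
  langevin_memLp : MemLp (langevin V g) 2 (gibbs V)

/-- `(lam i, φ i)`, `i ≥ 0`, is the spectral decomposition of `ℒ` in `L²(π)`: `φ 0 = 1`,
`0 = lam 0 < lam 1 ≤ lam 2 ≤ ⋯`, and the `φ i` form a complete orthonormal system of
eigenfunctions. -/
structure IsEigenbasis {d : ℕ} (V : Sp d → ℝ) (lam : ℕ → ℝ) (φ : ℕ → Sp d → ℝ) : Prop where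
  zero_fun : φ 0 = fun _ => 1
  zero_val : lam 0 = 0
  pos : 0 < lam 1
  mono : Monotone lam
  inDomain : ∀ i, InDomain V (φ i)
  eigen : ∀ i x, langevin V (φ i) x = lam i * φ i x
  orthonormal : ∀ i j, ip V (φ i) (φ j) = if i = j then 1 else 0
  complete : ∀ f : Sp d → ℝ, MemLp f 2 (gibbs V) → (∀ i, ip V f (φ i) = 0) →
    f =ᵐ[gibbs V] 0

/-- The orthogonal projection `Π_r f = ∑_{i=1}^r ⟨f, φ_i⟩_π φ_i`
onto `span {φ_1, …, φ_r}`. -/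
def proj {d : ℕ} (V : Sp d → ℝ) (φ : ℕ → Sp d → ℝ) (r : ℕ) (f : Sp d → ℝ) (x : Sp d) : ℝ :=
  ∑ i ∈ Finset.Icc 1 r, ip V f (φ i) * φ i x

/-- The rank-`r` approximate inverse `K̂_r f = ∑_{i=1}^r λ̂_i⁻¹ ⟨f, φ̂_i⟩_π φ̂_i`. -/
def Khat {d r : ℕ} (V : Sp d → ℝ) (lamh : Fin r → ℝ) (φh : Fin r → Sp d → ℝ)
    (f : Sp d → ℝ) (x : Sp d) : ℝ :=
  ∑ i, (1 / lamh i) * ip V f (φh i) * φh i x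

/-- The Koopman spectral approximation error `δ_r(f) = ℒ K̂_r f - Π_r f`. -/
def specErr {d r : ℕ} (V : Sp d → ℝ) (φ : ℕ → Sp d → ℝ) (lamh : Fin r → ℝ)
    (φh : Fin r → Sp d → ℝ) (f : Sp d → ℝ) (x : Sp d) : ℝ :=
  langevin V (Khat V lamh φh f) x - proj V φ r f x

/-- The density `ρ = dμ/dπ`. -/
def density {d : ℕ} (V : Sp d → ℝ) (μ : Measure (Sp d)) (x : Sp d) : ℝ :=
  (μ.rnDeriv (gibbs V) x).toReal

/-- The fluctuation `f = dμ/dπ - 1` of the density. -/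
def fluct {d : ℕ} (V : Sp d → ℝ) (μ : Measure (Sp d)) (x : Sp d) : ℝ :=
  density V μ x - 1

/-- The field `v̂ = ∇ K̂_r (dμ/dπ)`. -/
def velocity {d r : ℕ} (V : Sp d → ℝ) (lamh : Fin r → ℝ) (φh : Fin r → Sp d → ℝ)
    (μ : Measure (Sp d)) : Sp d → Sp d :=
  gradient (Khat V lamh φh (density V μ))

/-- The discrete iterates `μ_{t+1} = (I - h v̂_t)#μ_t`, with `v̂_t = ∇ K̂_r (dμ_t/dπ)`. -/
def iter {d r : ℕ} (V : Sp d → ℝ) (lamh : Fin r → ℝ) (φh : Fin r → Sp d → ℝ)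
    (h : ℝ) (μ₀ : Measure (Sp d)) : ℕ → Measure (Sp d)
  | 0 => μ₀
  | t + 1 => (iter V lamh φh h μ₀ t).map
      (fun x => x - h • velocity V lamh φh (iter V lamh φh h μ₀ t) x)

/-- The Kullback-Leibler divergence `KL(μ ‖ π)`, with values in `[0, ∞]`. -/
def kl {d : ℕ} (V : Sp d → ℝ) (μ : Measure (Sp d)) : ENNReal :=
  InformationTheory.klDiv μ (gibbs V)

/-- The potential `V` is `C²`, `exp (-V)` is integrable, and `∇²V ≤ L`. -/
structure IsPotential {d : ℕ} (L : ℝ) (V : Sp d → ℝ) : Prop where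
  contDiff : ContDiff ℝ 2 V
  integrable : Integrable (fun x => Real.exp (-V x)) (volume : Measure (Sp d))
  hessian_le : ∀ x u : Sp d, inner ℝ (fderiv ℝ (gradient V) x u) u ≤ L * ‖u‖ ^ 2

/-- Approximate eigenpairs: positive `λ̂_i`, and `φ̂_i` in the domain of `ℒ` with `π`-mean
zero. -/
structure IsApproxEigenpairs {d r : ℕ} (V : Sp d → ℝ) (lamh : Fin r → ℝ)
    (φh : Fin r → Sp d → ℝ) : Prop where
  pos : ∀ i, 0 < lamh i
  inDomain : ∀ i, InDomain V (φh i)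
  mean_zero : ∀ i, ∫ x, φh i x ∂(gibbs V) = 0

/-- The conditions on one iterate `μ`: it has a density with respect to `π` whose fluctuation
`f` lies in `L²(π)`; the spectral tail satisfies `‖(I - Π_r) f‖ ≤ η`; the operator error
satisfies `|⟨f, δ_r(f)⟩_π| ≤ ε ‖f‖²`; and the field `v̂` satisfies
`‖v̂‖_{L²(μ)} ≤ B` and `‖Dv̂(x)‖ ≤ B` for all `x`. -/
structure Conditions {d r : ℕ} (V : Sp d → ℝ) (φ : ℕ → Sp d → ℝ) (lamh : Fin r → ℝ)
    (φh : Fin r → Sp d → ℝ) (ε η B : ℝ) (μ : Measure (Sp d)) : Prop where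
  absCont : μ ≪ gibbs V
  memLp : MemLp (fluct V μ) 2 (gibbs V)
  tail : eLpNorm (fun x => fluct V μ x - proj V φ r (fluct V μ) x) 2 (gibbs V)
    ≤ ENNReal.ofReal η
  approx : |ip V (fluct V μ) (specErr V φ lamh φh (fluct V μ))|
    ≤ ε * ip V (fluct V μ) (fluct V μ)
  velocity_le : eLpNorm (velocity V lamh φh μ) 2 μ ≤ ENNReal.ofReal B
  fderiv_velocity_le : ∀ x, ‖fderiv ℝ (velocity V lamh φh μ) x‖ ≤ B

end KSWGD

end

namespace KSWGD

/-! ### Determinant, Hessian and integration-by-parts estimates -/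

section Calculus

variable {E : Type*} [NormedAddCommGroup E] [InnerProductSpace ℝ E]

/-! One step transports `μ` by `T = I - h∇g` with `g = K̂_r(dμ/dπ)`. The change of variables formula
gives `KL(T_#μ‖π) - KL(μ‖π) = ∫ (V∘T - V - log det DT) dμ`. The bound `∇²V ≤ L` and a second-order
bound on `-log det (I - h∇²g)` make the integrand at most `-h ℒg + O(h²)`: the drift comes from `V`,
the Laplacian from the determinant (`toReal_klDiv_map_le`, `le_quadratic_of_hessian_le`,
`det_one_sub_pos_and_neg_log_det_le`).

It remains to bound `∫ ℒg dμ` below. With `dμ/dπ = 1 + f` and `∫ ℒg dπ = 0`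
(`integral_langevin_eq_zero`), it equals `⟨f, ℒg⟩_π = ⟨f, Π_r f⟩_π + ⟨f, δ_r(f)⟩_π ≥ ‖f‖² - η² -
ε‖f‖²`. Since `KL ≤ ‖f‖²` (`toReal_klDiv_le_integral_sq`), one step contracts KL by `1 - (1-ε)h` up
to `hη² + Ch²`, and iterating sums a geometric series. The density of `μ` is never differentiated:
only `g` is, so `f ∈ L²(π)` suffices. -/

theorem neg_log_one_sub_le {u : ℝ} (hu : |u| ≤ 1 / 2) :
    -Real.log (1 - u) ≤ u + 2 * u ^ 2 := by
  obtain ⟨h1, h2⟩ := abs_le.mp hu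
  have hpos : 0 < 1 - u := by linarith
  have h := Real.one_sub_inv_le_log_of_pos hpos
  have h3 : (1 - u)⁻¹ ≤ 1 + u + 2 * u ^ 2 := by
    rw [inv_le_iff_one_le_mul₀ hpos]
    -- `(1 - u)(1 + u + 2u²) = 1 + u²(1 - 2u)`.
    nlinarith [mul_nonneg (sq_nonneg u) (by linarith : 0 ≤ 1 - 2 * u)]
  linarith

/-- Symmetry allows diagonalisation: every eigenvalue `m` of `I - A` satisfies `|1 - m| ≤ ‖A‖ ≤
1/2`, so the scalar inequality can be summed over the spectrum. -/
theorem det_one_sub_pos_and_neg_log_det_le [FiniteDimensional ℝ E] {A : E →L[ℝ] E}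
    (hA : (A : E →ₗ[ℝ] E).IsSymmetric) (hn : ‖A‖ ≤ 1 / 2) :
    0 < (ContinuousLinearMap.id ℝ E - A).det ∧
    -Real.log (ContinuousLinearMap.id ℝ E - A).det ≤
      LinearMap.trace ℝ E A + Module.finrank ℝ E * (2 * ‖A‖ ^ 2) := by
  set S : E →ₗ[ℝ] E := LinearMap.id - (A : E →ₗ[ℝ] E) with hS
  have hsymm : S.IsSymmetric := LinearMap.IsSymmetric.id.sub hA
  have hdet : (ContinuousLinearMap.id ℝ E - A).det = LinearMap.det S := rfl
  set m := hsymm.eigenvalues rfl with hm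
  have hb : ∀ i, |1 - m i| ≤ ‖A‖ := by
    intro i
    set v := hsymm.eigenvectorBasis rfl i
    have h1 : S v = m i • v := hsymm.apply_eigenvectorBasis rfl i
    have h2 : A v = (1 - m i) • v := by
      rw [sub_smul, ← h1, hS]; simp
    have h3 : ‖v‖ = 1 := (hsymm.eigenvectorBasis rfl).orthonormal.1 i
    have h4 := A.le_opNorm v
    rwa [h2, norm_smul, h3, mul_one, mul_one] at h4
  have hpos : ∀ i, 0 < m i := fun i => by
    have := abs_le.mp ((hb i).trans hn); linarith
  have hprod : LinearMap.det S = ∏ i, m i := hsymm.det_eq_prod_eigenvalues rfl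
  have htr : LinearMap.trace ℝ E S = ∑ i, m i := hsymm.trace_eq_sum_eigenvalues rfl
  have htr' : LinearMap.trace ℝ E A = ∑ i, (1 - m i) := by
    rw [Finset.sum_sub_distrib, ← htr, hS, map_sub, LinearMap.trace_id]; simp
  rw [hdet, hprod]
  refine ⟨Finset.prod_pos fun i _ => hpos i, ?_⟩
  rw [Real.log_prod fun i _ => (hpos i).ne', ← Finset.sum_neg_distrib, htr']
  have : (Module.finrank ℝ E : ℝ) * (2 * ‖A‖ ^ 2) =
      ∑ _i : Fin (Module.finrank ℝ E), 2 * ‖A‖ ^ 2 := by simp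
  rw [this, ← Finset.sum_add_distrib]
  refine Finset.sum_le_sum fun i _ => ?_
  have h1 := neg_log_one_sub_le ((hb i).trans hn)
  rw [sub_sub_cancel] at h1
  have h2 : (1 - m i) ^ 2 ≤ ‖A‖ ^ 2 := by
    rw [← sq_abs]; exact pow_le_pow_left₀ (abs_nonneg _) (hb i) 2
  linarith

variable [CompleteSpace E]

theorem gradient_eq_comp (g : E → ℝ) :
    gradient g = (InnerProductSpace.toDual ℝ E).symm ∘ fderiv ℝ g := rfl

theorem contDiff_gradient {g : E → ℝ} (hg : ContDiff ℝ 2 g) : ContDiff ℝ 1 (gradient g) := by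
  rw [gradient_eq_comp]
  exact (InnerProductSpace.toDual ℝ E).symm.toContinuousLinearEquiv.contDiff.comp
    (hg.fderiv_right (m := 1) (by norm_num))

theorem inner_fderiv_gradient {g : E → ℝ} (hg : ContDiff ℝ 2 g) (x u w : E) :
    inner ℝ (fderiv ℝ (gradient g) x u) w = fderiv ℝ (fderiv ℝ g) x u w := by
  have hd : DifferentiableAt ℝ (fderiv ℝ g) x :=
    ((hg.fderiv_right (m := 1) (by norm_num)).differentiable (by norm_num)) x
  have hgrad : DifferentiableAt ℝ (gradient g) x :=
    (contDiff_gradient hg).differentiable (by norm_num) x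
  have h1 := (hgrad.hasFDerivAt.inner ℝ (hasFDerivAt_const w x)).fderiv
  have h2 := (hd.hasFDerivAt.clm_apply (hasFDerivAt_const w x)).fderiv
  have h3 : (fun y => inner ℝ (gradient g y) w) = fun y => fderiv ℝ g y w :=
    funext fun y => inner_gradient_left
  have h4 := congrArg (fun T : E →L[ℝ] ℝ => T u) (h1.symm.trans ((congrArg
    (fun F : E → ℝ => fderiv ℝ F x) h3).trans h2))
  simpa using h4

theorem isSymmetric_fderiv_gradient {g : E → ℝ} (hg : ContDiff ℝ 2 g) (x : E) :
    (fderiv ℝ (gradient g) x : E →ₗ[ℝ] E).IsSymmetric := by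
  intro u w
  have hs : IsSymmSndFDerivAt ℝ g x := hg.contDiffAt.isSymmSndFDerivAt (by simp)
  change inner ℝ (fderiv ℝ (gradient g) x u) w = inner ℝ u (fderiv ℝ (gradient g) x w)
  rw [inner_fderiv_gradient hg, real_inner_comm, inner_fderiv_gradient hg]
  exact hs u w

theorem laplacian_eq_trace [FiniteDimensional ℝ E] {g : E → ℝ} (hg : ContDiff ℝ 2 g) (x : E) :
    Laplacian.laplacian g x = LinearMap.trace ℝ E (fderiv ℝ (gradient g) x : E →ₗ[ℝ] E) := by
  rw [InnerProductSpace.laplacian_eq_iteratedFDeriv_stdOrthonormalBasis,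
    LinearMap.trace_eq_sum_inner _ (stdOrthonormalBasis ℝ E)]
  refine Finset.sum_congr rfl fun i _ => ?_
  rw [real_inner_comm, ContinuousLinearMap.coe_coe, inner_fderiv_gradient hg,
    iteratedFDeriv_two_apply]
  rfl

theorem le_quadratic_of_hessian_le {V : E → ℝ} {L : ℝ} (hV : ContDiff ℝ 2 V)
    (hL : ∀ x u : E, inner ℝ (fderiv ℝ (gradient V) x u) u ≤ L * ‖u‖ ^ 2) (x u : E) :
    V (x + u) ≤ V x + inner ℝ (gradient V x) u + L / 2 * ‖u‖ ^ 2 := by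
  have hl : ∀ s : ℝ, HasDerivAt (fun s : ℝ => x + s • u) u s := fun s => by
    simpa using ((hasDerivAt_id s).smul_const u).const_add x
  have h1 : ∀ s : ℝ, HasDerivAt (fun s : ℝ => V (x + s • u)) (fderiv ℝ V (x + s • u) u) s :=
    fun s => (hV.differentiable (by norm_num) _).hasFDerivAt.comp_hasDerivAt s (hl s)
  have h2 : ∀ s : ℝ, HasDerivAt (fun s : ℝ => fderiv ℝ V (x + s • u) u)
      (fderiv ℝ (fderiv ℝ V) (x + s • u) u u) s := fun s => by
    have hd : DifferentiableAt ℝ (fderiv ℝ V) (x + s • u) :=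
      ((hV.fderiv_right (m := 1) (by norm_num)).differentiable (by norm_num)) _
    have := hd.hasFDerivAt.comp_hasDerivAt s (hl s)
    simpa using this.clm_apply (hasDerivAt_const s u)
  set c := fderiv ℝ V x u with hc
  set K := L * ‖u‖ ^ 2 with hK
  -- Along the segment the second derivative is at most `K`, so the first derivative minus its
  -- affine majorant decreases from its value `0` at `s = 0`.
  have hanti : Antitone (fun s : ℝ => fderiv ℝ V (x + s • u) u - c - K * s) := by
    refine antitone_of_hasDerivAt_nonpos (f' := fun s => fderiv ℝ (fderiv ℝ V) (x + s • u) u u - K)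
      (fun s => ?_) fun s => ?_
    · have := ((h2 s).sub_const c).sub ((hasDerivAt_id s).const_mul K)
      rw [mul_one] at this
      exact this
    · have := hL (x + s • u) u
      rw [inner_fderiv_gradient hV] at this
      simpa using this
  -- The derivative is known to be nonpositive only for `s ≥ 0`; comparing `s = 0` with `s = 1`
  -- gives the claim.
  have hanti2 : AntitoneOn (fun s : ℝ => V (x + s • u) - c * s - K / 2 * s ^ 2) (Set.Ici 0) := by
    have hd : ∀ s : ℝ, HasDerivAt (fun s : ℝ => V (x + s • u) - c * s - K / 2 * s ^ 2)
        (fderiv ℝ V (x + s • u) u - c - K * s) s := fun s => by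
      have := ((h1 s).sub ((hasDerivAt_id s).const_mul c)).sub
        ((hasDerivAt_pow 2 s).const_mul (K / 2))
      convert! this using 1
      simp; ring
    refine antitoneOn_of_hasDerivWithinAt_nonpos (convex_Ici 0)
      (fun s _ => (hd s).continuousAt.continuousWithinAt)
      (fun s _ => (hd s).hasDerivWithinAt) fun s hs => ?_
    rw [interior_Ici] at hs
    have := hanti (le_of_lt hs : (0 : ℝ) ≤ s)
    simpa [hc] using this
  have := hanti2 (Set.mem_Ici.mpr le_rfl) (Set.mem_Ici.mpr zero_le_one) zero_le_one
  simp only [one_smul, zero_smul, add_zero] at this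
  rw [inner_gradient_left]
  simp only [← hc]
  linarith

theorem integral_mul_laplacian [FiniteDimensional ℝ E] [MeasurableSpace E] [BorelSpace E]
    {ψ g : E → ℝ} (hψ : ContDiff ℝ 1 ψ) (hc : HasCompactSupport ψ) (hg : ContDiff ℝ 2 g) :
    ∫ x, ψ x * Laplacian.laplacian g x = -∫ x, fderiv ℝ ψ x (gradient g x) := by
  set b := stdOrthonormalBasis ℝ E
  have hgi : ∀ i, ContDiff ℝ 1 (fun x => fderiv ℝ g x (b i)) := fun i =>
    (hg.fderiv_right (m := 1) (by norm_num)).clm_apply contDiff_const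
  have hψi : ∀ i, Continuous (fun x => fderiv ℝ ψ x (b i)) := fun i =>
    (hψ.continuous_fderiv (by norm_num)).clm_apply continuous_const
  have hgii : ∀ i, Continuous (fun x => fderiv ℝ (fun x => fderiv ℝ g x (b i)) x (b i)) :=
    fun i => ((hgi i).continuous_fderiv (by norm_num)).clm_apply continuous_const
  have hci : ∀ i, HasCompactSupport (fun x => fderiv ℝ ψ x (b i)) := fun i =>
    hc.fderiv_apply ℝ (b i)
  have hlap : ∀ x, ψ x * Laplacian.laplacian g x =
      ∑ i, ψ x * fderiv ℝ (fun x => fderiv ℝ g x (b i)) x (b i) := fun x => by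
    rw [InnerProductSpace.laplacian_eq_iteratedFDeriv_stdOrthonormalBasis]
    simp only
    rw [Finset.mul_sum]
    refine Finset.sum_congr rfl fun i _ => ?_
    have hd : DifferentiableAt ℝ (fderiv ℝ g) x :=
      ((hg.fderiv_right (m := 1) (by norm_num)).differentiable (by norm_num)) x
    rw [iteratedFDeriv_two_apply, fderiv_clm_apply hd (differentiableAt_const _)]
    simp [b]
  have hin : ∀ x, fderiv ℝ ψ x (gradient g x) =
      ∑ i, fderiv ℝ ψ x (b i) * fderiv ℝ g x (b i) := fun x => by
    rw [← inner_gradient_left, ← b.sum_inner_mul_inner]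
    refine Finset.sum_congr rfl fun i _ => ?_
    rw [inner_gradient_left, real_inner_comm, inner_gradient_left]
  have hI1 : ∀ i, Integrable
      (fun x => ψ x * fderiv ℝ (fun x => fderiv ℝ g x (b i)) x (b i)) := fun i =>
    (hψ.continuous.mul (hgii i)).integrable_of_hasCompactSupport hc.mul_right
  have hI2 : ∀ i, Integrable (fun x => fderiv ℝ ψ x (b i) * fderiv ℝ g x (b i)) := fun i =>
    ((hψi i).mul (hgi i).continuous).integrable_of_hasCompactSupport (hci i).mul_right
  simp_rw [hlap, hin]
  rw [integral_finsetSum _ fun i _ => hI1 i, integral_finsetSum _ fun i _ => hI2 i,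
    ← Finset.sum_neg_distrib]
  refine Finset.sum_congr rfl fun i _ => ?_
  exact integral_mul_fderiv_eq_neg_fderiv_mul_of_integrable (hI2 i) (hI1 i)
    ((hψ.continuous.mul (hgi i).continuous).integrable_of_hasCompactSupport hc.mul_right)
    (fun x _ => hψ.differentiable (by norm_num) x)
    (fun x _ => (hgi i).differentiable (by norm_num) x)

end Calculus

open InformationTheory Filter Topology

/-! ### The generator on its domain and its mean under the Gibbs measure -/

section Gibbs

variable {d : ℕ} {L : ℝ} {V : Sp d → ℝ}

theorem IsPotential.isProbabilityMeasure (hV : IsPotential L V) :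
    IsProbabilityMeasure (gibbs V) :=
  isProbabilityMeasure_tilted hV.integrable

theorem InDomain.zero : InDomain V (0 : Sp d → ℝ) := by
  have h1 : gradient (0 : Sp d → ℝ) = 0 := by ext1 x; exact gradient_const x 0
  have h2 : langevin V (0 : Sp d → ℝ) = 0 := by
    ext1 x
    have h3 : Laplacian.laplacian (0 : Sp d → ℝ) x = 0 :=
      congrFun (InnerProductSpace.laplacian_const (E := Sp d) (c := (0 : ℝ))) x
    simp [langevin, h1, h3]
  exact ⟨contDiff_const, MemLp.zero, by rw [h1]; exact MemLp.zero, by rw [h2]; exact MemLp.zero⟩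

theorem InDomain.add {f g : Sp d → ℝ} (hf : InDomain V f) (hg : InDomain V g) :
    InDomain V (f + g) := by
  have h1 : gradient (f + g) = gradient f + gradient g := by
    ext1 x
    simp only [gradient, Pi.add_apply]
    rw [fderiv_add (hf.contDiff.differentiable (by norm_num) x)
      (hg.contDiff.differentiable (by norm_num) x), map_add]
  have h2 : langevin V (f + g) = langevin V f + langevin V g := by
    ext1 x
    simp only [langevin, h1, Pi.add_apply, inner_add_right]
    rw [hf.contDiff.contDiffAt.laplacian_add hg.contDiff.contDiffAt]
    ring
  exact ⟨hf.contDiff.add hg.contDiff, hf.memLp.add hg.memLp,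
    h1 ▸ hf.grad_memLp.add hg.grad_memLp, h2 ▸ hf.langevin_memLp.add hg.langevin_memLp⟩

theorem InDomain.const_smul {f : Sp d → ℝ} (hf : InDomain V f) (c : ℝ) :
    InDomain V (c • f) := by
  have h1 : gradient (c • f) = c • gradient f := by
    ext1 x
    simp only [gradient, Pi.smul_apply]
    rw [fderiv_const_smul (hf.contDiff.differentiable (by norm_num) x)]
    simp
  have h2 : langevin V (c • f) = c • langevin V f := by
    ext1 x
    simp only [langevin, h1, Pi.smul_apply, inner_smul_right, smul_eq_mul]
    rw [InnerProductSpace.laplacian_smul c hf.contDiff.contDiffAt]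
    simp only [smul_eq_mul]
    ring
  exact ⟨hf.contDiff.const_smul c, hf.memLp.const_smul c,
    h1 ▸ hf.grad_memLp.const_smul c, h2 ▸ hf.langevin_memLp.const_smul c⟩

theorem InDomain.sum {ι : Type*} {f : ι → Sp d → ℝ} (s : Finset ι)
    (hf : ∀ i ∈ s, InDomain V (f i)) : InDomain V (∑ i ∈ s, f i) :=
  Finset.sum_induction f (InDomain V) (fun _ _ => InDomain.add) InDomain.zero hf

theorem InDomain.khat {r : ℕ} {lamh : Fin r → ℝ} {φh : Fin r → Sp d → ℝ}
    (hφ : ∀ i, InDomain V (φh i)) (f : Sp d → ℝ) :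
    InDomain V (Khat V lamh φh f) := by
  have : Khat V lamh φh f = ∑ i, ((1 / lamh i) * ip V f (φh i)) • φh i := by
    ext x; simp [Khat]
  rw [this]
  exact InDomain.sum _ fun i _ => (hφ i).const_smul _

/-- Integrate by parts against `χ e^{-V}`: differentiating the weight produces exactly the drift
term of `ℒ`, and the normalising constant cancels. -/
theorem integral_mul_langevin (hV : IsPotential L V) {χ g : Sp d → ℝ} (hχ : ContDiff ℝ 1 χ)
    (hc : HasCompactSupport χ) (hg : ContDiff ℝ 2 g) :
    ∫ x, χ x * langevin V g x ∂(gibbs V) = ∫ x, fderiv ℝ χ x (gradient g x) ∂(gibbs V) := by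
  set w : Sp d → ℝ := fun x => Real.exp (-V x) with hw
  have hV1 : ContDiff ℝ 1 V := hV.contDiff.of_le (by norm_num)
  have hwd : ContDiff ℝ 1 w := hV1.neg.exp
  have hψ : ContDiff ℝ 1 (fun x => χ x * w x) := hχ.mul hwd
  have hψc : HasCompactSupport (fun x => χ x * w x) := hc.mul_right
  have hgc : Continuous (gradient g) := (contDiff_gradient hg).continuous
  have hVc : Continuous (gradient V) := (contDiff_gradient hV.contDiff).continuous
  have hlap : Continuous (Laplacian.laplacian g) := by
    rw [show Laplacian.laplacian g = _ from funext fun x => laplacian_eq_trace hg x]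
    have h1 : Continuous (fun x => fderiv ℝ (gradient g) x) :=
      (contDiff_gradient hg).continuous_fderiv (by norm_num)
    let tr : (Sp d →L[ℝ] Sp d) →ₗ[ℝ] ℝ :=
      LinearMap.trace ℝ (Sp d) ∘ₗ ContinuousLinearMap.coeLM ℝ
    exact tr.continuous_of_finiteDimensional.comp h1
  have hfd : ∀ x, fderiv ℝ (fun x => χ x * w x) x (gradient g x) =
      w x * fderiv ℝ χ x (gradient g x) -
        χ x * w x * inner ℝ (gradient V x) (gradient g x) := fun x => by
    have h1 := (hχ.differentiable (by norm_num) x).hasFDerivAt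
    have h2 := (hV1.differentiable (by norm_num) x).hasFDerivAt.neg.exp
    have h3 := (h1.mul h2).fderiv
    rw [show (fun x => χ x * w x) = (χ * fun x => Real.exp ((-V) x)) from rfl, h3,
      inner_gradient_left]
    simp [hw]
    ring
  have hI1 : Integrable (fun x => w x * fderiv ℝ χ x (gradient g x)) := by
    refine Continuous.integrable_of_hasCompactSupport
      (hwd.continuous.mul ((hχ.continuous_fderiv (by norm_num)).clm_apply hgc)) ?_
    refine HasCompactSupport.mul_left ((hc.fderiv ℝ).mono fun x hx => ?_)
    rw [Function.mem_support] at hx ⊢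
    intro h0
    exact hx (by simp [h0])
  have hI2 : Integrable (fun x => χ x * w x * inner ℝ (gradient V x) (gradient g x)) :=
    (hψ.continuous.mul (hVc.inner hgc)).integrable_of_hasCompactSupport hψc.mul_right
  have hI3 : Integrable (fun x => χ x * w x * Laplacian.laplacian g x) :=
    (hψ.continuous.mul hlap).integrable_of_hasCompactSupport hψc.mul_right
  have key := integral_mul_laplacian hψ hψc hg
  simp_rw [hfd] at key
  rw [integral_sub hI1 hI2] at key
  have h1 : ∫ x, w x * (χ x * langevin V g x) = ∫ x, w x * fderiv ℝ χ x (gradient g x) := by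
    have : ∀ x, w x * (χ x * langevin V g x) =
        χ x * w x * inner ℝ (gradient V x) (gradient g x) -
          χ x * w x * Laplacian.laplacian g x := fun x => by
      simp only [langevin]; ring
    simp_rw [this]
    rw [integral_sub hI2 hI3, key]
    ring
  rw [gibbs, integral_tilted, integral_tilted]
  simp only [smul_eq_mul, div_mul_eq_mul_div, integral_div]
  rw [h1]

/-- Test against the cutoffs `χ(x/(n+1))`. Their gradients are `O(1/(n+1))`, so integrability of
`∇g` and `ℒg` lets dominated convergence send one side to `∫ ℒg dπ` and the other to `0`. -/
theorem integral_langevin_eq_zero (hV : IsPotential L V) {g : Sp d → ℝ} (hg : InDomain V g) :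
    ∫ x, langevin V g x ∂(gibbs V) = 0 := by
  have := hV.isProbabilityMeasure
  let f : ContDiffBump (0 : Sp d) := ⟨1, 2, by norm_num, by norm_num⟩
  have hf : ContDiff ℝ 1 f := f.contDiff
  obtain ⟨M, hM⟩ := (hf.continuous_fderiv (by norm_num)).bounded_above_of_compact_support
    (f.hasCompactSupport.fderiv ℝ)
  set a : ℕ → ℝ := fun n => 1 / ((n : ℝ) + 1) with ha
  have ha0 : Tendsto a atTop (𝓝 0) := tendsto_one_div_add_atTop_nhds_zero_nat
  have hapos : ∀ n, 0 < a n := fun n => by positivity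
  have hale : ∀ n, a n ≤ 1 := fun n => by
    rw [ha]; exact div_le_one_of_le₀ (by linarith [(Nat.cast_nonneg n : (0 : ℝ) ≤ n)])
      (by positivity)
  have hfd : ∀ n x, fderiv ℝ (fun x => f (a n • x)) x = a n • fderiv ℝ f (a n • x) := by
    intro n x
    exact fderiv_comp_smul (f := f) (a n)
  have hM0 : 0 ≤ M := (norm_nonneg _).trans (hM 0)
  have hMb : ∀ n x, ‖fderiv ℝ (fun x => f (a n • x)) x (gradient g x)‖ ≤
      a n * (M * ‖gradient g x‖) := fun n x => by
    rw [hfd, _root_.smul_apply, norm_smul, Real.norm_of_nonneg (hapos n).le]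
    exact mul_le_mul_of_nonneg_left (((fderiv ℝ f (a n • x)).le_opNorm _).trans
      (mul_le_mul_of_nonneg_right (hM _) (norm_nonneg _))) (hapos n).le
  have hcd : ∀ n, ContDiff ℝ 1 (fun x => f (a n • x)) := fun n =>
    hf.comp (contDiff_const_smul (a n))
  have hL1 : Integrable (langevin V g) (gibbs V) := hg.langevin_memLp.integrable (by norm_num)
  have hG1 : Integrable (fun x => M * ‖gradient g x‖) (gibbs V) :=
    (hg.grad_memLp.integrable (by norm_num)).norm.const_mul M
  have hgc : Continuous (gradient g) := (contDiff_gradient hg.contDiff).continuous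
  have hlim1 : Tendsto (fun n => ∫ x, f (a n • x) * langevin V g x ∂(gibbs V)) atTop
      (𝓝 (∫ x, langevin V g x ∂(gibbs V))) := by
    refine tendsto_integral_of_dominated_convergence (fun x => ‖langevin V g x‖)
      (fun n => (hcd n).continuous.aestronglyMeasurable.mul hL1.aestronglyMeasurable)
      hL1.norm (fun n => ae_of_all _ fun x => ?_) (ae_of_all _ fun x => ?_)
    · rw [norm_mul, Real.norm_of_nonneg f.nonneg]
      exact mul_le_of_le_one_left (norm_nonneg _) f.le_one
    · have h1 : Tendsto (fun n => f (a n • x)) atTop (𝓝 (f 0)) := by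
        refine (hf.continuous.tendsto 0).comp ?_
        simpa using ha0.smul_const x
      have h2 : f 0 = 1 := f.one_of_mem_closedBall (by simp [f])
      simpa [h2] using h1.mul_const (langevin V g x)
  have hlim2 : Tendsto (fun n => ∫ x, fderiv ℝ (fun x => f (a n • x)) x (gradient g x)
      ∂(gibbs V)) atTop (𝓝 (∫ _, (0 : ℝ) ∂(gibbs V))) := by
    refine tendsto_integral_of_dominated_convergence (fun x => M * ‖gradient g x‖)
      (fun n => (((hcd n).continuous_fderiv (by norm_num)).clm_apply hgc).aestronglyMeasurable)
      hG1 (fun n => ae_of_all _ fun x => ?_) (ae_of_all _ fun x => ?_)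
    · exact (hMb n x).trans (mul_le_of_le_one_left (by positivity) (hale n))
    · refine squeeze_zero_norm (fun n => hMb n x) ?_
      simpa using ha0.mul_const (M * ‖gradient g x‖)
  have heq : ∀ n, ∫ x, f (a n • x) * langevin V g x ∂(gibbs V) =
      ∫ x, fderiv ℝ (fun x => f (a n • x)) x (gradient g x) ∂(gibbs V) := fun n =>
    integral_mul_langevin hV (hcd n)
      (f.hasCompactSupport.comp_smul (hapos n).ne') hg.contDiff
  simp_rw [heq] at hlim1
  simpa using tendsto_nhds_unique hlim1 hlim2

end Gibbs

/-! ### KL divergence: comparison with chi-square and change of variables -/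

section Divergence

variable {d : ℕ} {V : Sp d → ℝ}

/-- For a density value `y ≥ 0`, `|y log y| ≤ 1 + y²`. -/
theorem integrable_llr_of_memLp {α : Type*} [MeasurableSpace α] {μ ν : Measure α}
    [IsFiniteMeasure μ] [IsFiniteMeasure ν] (hac : μ ≪ ν)
    (h2 : MemLp (fun x => (μ.rnDeriv ν x).toReal) 2 ν) : Integrable (llr μ ν) μ := by
  rw [← integrable_rnDeriv_mul_log_iff hac]
  have hm : Measurable fun x => (μ.rnDeriv ν x).toReal :=
    (Measure.measurable_rnDeriv μ ν).ennreal_toReal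
  refine ((integrable_const (1 : ℝ)).add h2.integrable_sq).mono'
    (hm.mul hm.log).aestronglyMeasurable (ae_of_all _ fun x => ?_)
  have h0 : 0 ≤ (μ.rnDeriv ν x).toReal := ENNReal.toReal_nonneg
  simp only [Pi.add_apply, Real.norm_eq_abs]
  generalize (μ.rnDeriv ν x).toReal = y at *
  rcases h0.eq_or_lt with rfl | hy
  · simp
  have h3 := Real.log_le_sub_one_of_pos hy
  have h4 := Real.one_sub_inv_le_log_of_pos hy
  have h5 : y * (1 - y⁻¹) = y - 1 := by field_simp
  rw [abs_le]
  constructor <;> nlinarith [mul_le_mul_of_nonneg_left h4 hy.le,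
    mul_le_mul_of_nonneg_left h3 hy.le]

/-- Integrate `log ρ ≤ ρ - 1` against `μ`; then `∫ ρ(ρ-1) dν = ∫ (ρ-1)² dν`, because `ρ - 1` has
`ν`-mean zero. -/
theorem toReal_klDiv_le_integral_sq {α : Type*} [MeasurableSpace α] {μ ν : Measure α}
    [IsProbabilityMeasure μ] [IsProbabilityMeasure ν] (hac : μ ≪ ν)
    (h2 : MemLp (fun x => (μ.rnDeriv ν x).toReal) 2 ν) :
    (klDiv μ ν).toReal ≤
      ∫ x, ((μ.rnDeriv ν x).toReal - 1) * ((μ.rnDeriv ν x).toReal - 1) ∂ν := by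
  have hI1 : Integrable (fun x => (μ.rnDeriv ν x).toReal) ν := h2.integrable (by norm_num)
  have hI2 : Integrable
      (fun x => (μ.rnDeriv ν x).toReal • ((μ.rnDeriv ν x).toReal - 1)) ν := by
    have := h2.integrable_sq.sub hI1
    refine this.congr (ae_of_all _ fun x => ?_)
    simp; ring
  rw [toReal_klDiv_of_measure_eq hac (by simp)]
  have hle : ∫ x, llr μ ν x ∂μ ≤ ∫ x, ((μ.rnDeriv ν x).toReal - 1) ∂μ := by
    refine integral_mono_ae (integrable_llr_of_memLp hac h2)
      ((integrable_rnDeriv_smul_iff hac).mp hI2) ?_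
    filter_upwards [Measure.rnDeriv_pos hac, hac.ae_le (Measure.rnDeriv_lt_top μ ν)] with x h1 h3
    exact Real.log_le_sub_one_of_pos (ENNReal.toReal_pos h1.ne' h3.ne)
  refine hle.trans_eq ?_
  rw [← integral_rnDeriv_smul hac]
  have h1 : ∫ x, (μ.rnDeriv ν x).toReal ∂ν = 1 := by
    rw [Measure.integral_toReal_rnDeriv hac]; simp
  have h3 : ∀ x, (μ.rnDeriv ν x).toReal • ((μ.rnDeriv ν x).toReal - 1) =
      ((μ.rnDeriv ν x).toReal - 1) * ((μ.rnDeriv ν x).toReal - 1) +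
        ((μ.rnDeriv ν x).toReal - 1) := fun x => by simp; ring
  simp_rw [h3]
  have hI3 : Integrable (fun x => (μ.rnDeriv ν x).toReal - 1) ν := hI1.sub (integrable_const 1)
  have hI4 : Integrable (fun x => ((μ.rnDeriv ν x).toReal - 1) *
      ((μ.rnDeriv ν x).toReal - 1)) ν := by
    refine (hI2.sub hI3).congr (ae_of_all _ fun x => ?_)
    simp; ring
  rw [integral_add hI4 hI3, integral_sub hI1 (integrable_const 1), h1]
  simp

/-- The change of variables formula is read backwards, expressing `μ` through the density of its
image. No inverse of `T` has to be constructed or differentiated; injectivity is enough. -/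
theorem eq_withDensity_of_map {μ : Measure (Sp d)} [IsFiniteMeasure μ]
    [SigmaFinite (gibbs V)]
    (hVm : Measurable V) {T : Sp d → Sp d} {T' : Sp d → Sp d →L[ℝ] Sp d}
    (hT : ∀ x, HasFDerivAt T (T' x) x) (hT' : Continuous T') (hinj : Function.Injective T)
    (hac : μ.map T ≪ gibbs V) :
    μ = (gibbs V).withDensity (fun x => (μ.map T).rnDeriv (gibbs V) (T x) *
      ENNReal.ofReal (Real.exp (V x - V (T x)) * |(T' x).det|)) := by
  have hTc : Continuous T := continuous_iff_continuousAt.mpr fun x => (hT x).continuousAt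
  have hTm : Measurable T := hTc.measurable
  set q := (μ.map T).rnDeriv (gibbs V) with hq
  have hqm : Measurable q := Measure.measurable_rnDeriv _ _
  set Z := ∫ x : Sp d, Real.exp (-V x) with hZ
  have hZ0 : 0 ≤ Z := integral_nonneg fun x => (Real.exp_pos _).le
  set p : Sp d → ENNReal := fun x => ENNReal.ofReal (Real.exp (-V x) / Z) with hp
  have hpm : Measurable p := (hVm.neg.exp.div_const Z).ennreal_ofReal
  have hg : gibbs V = volume.withDensity p := rfl
  have hdet : Measurable fun x => (T' x).det :=
    (ContinuousLinearMap.continuous_det.comp hT').measurable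
  have hwm : Measurable fun x =>
      ENNReal.ofReal (Real.exp (V x - V (T x)) * |(T' x).det|) :=
    ((hVm.sub (hVm.comp hTm)).exp.mul hdet.abs).ennreal_ofReal
  ext A hA
  have hTA : MeasurableSet (T '' A) :=
    measurable_image_of_fderivWithin hA (fun x _ => (hT x).hasFDerivWithinAt) hinj.injOn
  calc μ A = μ.map T (T '' A) := by
        rw [Measure.map_apply hTm hTA, hinj.preimage_image]
    _ = ∫⁻ x in T '' A, q x ∂(gibbs V) := by
        rw [← withDensity_apply _ hTA, hq, Measure.withDensity_rnDeriv_eq _ _ hac]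
    _ = ∫⁻ x in T '' A, p x * q x := by
        rw [hg, setLIntegral_withDensity_eq_setLIntegral_mul _ hpm hqm hTA]; rfl
    _ = ∫⁻ x in A, ENNReal.ofReal |(T' x).det| * (p (T x) * q (T x)) :=
        lintegral_image_eq_lintegral_abs_det_fderiv_mul volume hA
          (fun x _ => (hT x).hasFDerivWithinAt) hinj.injOn _
    _ = ∫⁻ x in A, p x *
          (q (T x) * ENNReal.ofReal (Real.exp (V x - V (T x)) * |(T' x).det|)) := by
        refine lintegral_congr fun x => ?_
        have : ENNReal.ofReal |(T' x).det| * p (T x) =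
            p x * ENNReal.ofReal (Real.exp (V x - V (T x)) * |(T' x).det|) := by
          rw [hp, ← ENNReal.ofReal_mul (abs_nonneg _),
            ← ENNReal.ofReal_mul (div_nonneg (Real.exp_pos _).le hZ0)]
          congr 1
          rw [show -V (T x) = -V x + (V x - V (T x)) by ring, Real.exp_add]
          ring
        rw [← mul_assoc, this]
        ring
    _ = _ := by
        rw [withDensity_apply _ hA, hg]
        exact (setLIntegral_withDensity_eq_setLIntegral_mul _ hpm ((hqm.comp hTm).mul hwm)
          hA).symm

theorem llr_eq_llr_map_comp {μ : Measure (Sp d)} [IsFiniteMeasure μ]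
    [SigmaFinite (gibbs V)]
    (hVm : Measurable V) {T : Sp d → Sp d} {T' : Sp d → Sp d →L[ℝ] Sp d}
    (hT : ∀ x, HasFDerivAt T (T' x) x) (hT' : Continuous T') (hinj : Function.Injective T)
    (hdet : ∀ x, 0 < (T' x).det) (hμ : μ ≪ gibbs V) (hac : μ.map T ≪ gibbs V) :
    ∀ᵐ x ∂μ, llr (μ.map T) (gibbs V) (T x) =
      llr μ (gibbs V) x + (V (T x) - V x - Real.log (T' x).det) := by
  have hTc : Continuous T := continuous_iff_continuousAt.mpr fun x => (hT x).continuousAt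
  have heq := eq_withDensity_of_map hVm hT hT' hinj hac
  have hm : Measurable (fun x => (μ.map T).rnDeriv (gibbs V) (T x) *
      ENNReal.ofReal (Real.exp (V x - V (T x)) * |(T' x).det|)) :=
    ((Measure.measurable_rnDeriv _ _).comp hTc.measurable).mul
      ((hVm.sub (hVm.comp hTc.measurable)).exp.mul
        (ContinuousLinearMap.continuous_det.comp hT').measurable.abs).ennreal_ofReal
  have hrn : μ.rnDeriv (gibbs V) =ᵐ[gibbs V] (fun x => (μ.map T).rnDeriv (gibbs V) (T x) *
      ENNReal.ofReal (Real.exp (V x - V (T x)) * |(T' x).det|)) := by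
    -- Only the left side is rewritten, since the right side also contains `μ`, through `μ.map T`.
    conv_lhs => rw [heq]
    exact Measure.rnDeriv_withDensity _ hm
  filter_upwards [hμ.ae_le hrn, Measure.rnDeriv_pos hμ,
    hμ.ae_le (Measure.rnDeriv_lt_top μ (gibbs V))] with x h1 h2 h3
  have hw : 0 < Real.exp (V x - V (T x)) * |(T' x).det| :=
    mul_pos (Real.exp_pos _) (abs_pos.mpr (hdet x).ne')
  have hpos := ENNReal.toReal_pos h2.ne' h3.ne
  simp only [llr]
  rw [h1, ENNReal.toReal_mul, ENNReal.toReal_ofReal hw.le] at hpos ⊢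
  have hq : ((μ.map T).rnDeriv (gibbs V) (T x)).toReal ≠ 0 := fun h0 => by
    rw [h0, zero_mul] at hpos; exact hpos.false
  rw [Real.log_mul hq hw.ne', Real.log_mul (Real.exp_pos _).ne' (abs_pos.mpr (hdet x).ne').ne',
    Real.log_exp, abs_of_pos (hdet x)]
  ring

theorem toReal_klDiv_map_le {μ : Measure (Sp d)} [IsProbabilityMeasure μ]
    [IsProbabilityMeasure (gibbs V)]
    (hVm : Measurable V) {T : Sp d → Sp d} {T' : Sp d → Sp d →L[ℝ] Sp d}
    (hT : ∀ x, HasFDerivAt T (T' x) x) (hT' : Continuous T') (hinj : Function.Injective T)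
    (hdet : ∀ x, 0 < (T' x).det) (hμ : klDiv μ (gibbs V) ≠ ⊤)
    (hν : klDiv (μ.map T) (gibbs V) ≠ ⊤) {b : Sp d → ℝ} (hb : Integrable b μ)
    (hle : ∀ x, V (T x) - V x - Real.log (T' x).det ≤ b x) :
    (klDiv (μ.map T) (gibbs V)).toReal ≤ (klDiv μ (gibbs V)).toReal + ∫ x, b x ∂μ := by
  have hTc : Continuous T := continuous_iff_continuousAt.mpr fun x => (hT x).continuousAt
  have hTm : AEMeasurable T μ := hTc.measurable.aemeasurable
  have := Measure.isProbabilityMeasure_map hTm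
  obtain ⟨hμac, hμI⟩ := klDiv_ne_top_iff.mp hμ
  obtain ⟨hνac, hνI⟩ := klDiv_ne_top_iff.mp hν
  rw [toReal_klDiv_of_measure_eq hμac (by simp), toReal_klDiv_of_measure_eq hνac (by simp),
    integral_map hTm hνI.aestronglyMeasurable, ← integral_add hμI hb]
  refine integral_mono_ae (hνI.comp_aemeasurable hTm) (hμI.add hb) ?_
  filter_upwards [llr_eq_llr_map_comp hVm hT hT' hinj hdet hμac hνac] with x hx
  rw [hx]
  linarith [hle x]

end Divergence

/-! ### One step of the iteration -/

section Step

variable {d : ℕ} {L : ℝ} {V : Sp d → ℝ}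

theorem ip_comm (f g : Sp d → ℝ) : ip V f g = ip V g f := by
  simp only [ip, mul_comm]

theorem ip_sub_right {f g k : Sp d → ℝ} (hf : MemLp f 2 (gibbs V)) (hg : MemLp g 2 (gibbs V))
    (hk : MemLp k 2 (gibbs V)) : ip V f (fun x => g x - k x) = ip V f g - ip V f k := by
  simp only [ip, mul_sub]
  exact integral_sub (hf.integrable_mul hg) (hf.integrable_mul hk)

theorem memLp_proj {φ : ℕ → Sp d → ℝ} (hφ : ∀ i, MemLp (φ i) 2 (gibbs V)) (r : ℕ)
    (f : Sp d → ℝ) : MemLp (proj V φ r f) 2 (gibbs V) :=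
  memLp_finsetSum _ fun i _ => (hφ i).const_mul (ip V f (φ i))

theorem ip_proj {φ : ℕ → Sp d → ℝ} (hφ : ∀ i, MemLp (φ i) 2 (gibbs V)) (r : ℕ)
    (f : Sp d → ℝ) {g : Sp d → ℝ} (hg : MemLp g 2 (gibbs V)) :
    ip V g (proj V φ r f) = ∑ i ∈ Finset.Icc 1 r, ip V f (φ i) * ip V g (φ i) := by
  have h1 : ∀ x, g x * proj V φ r f x =
      ∑ i ∈ Finset.Icc 1 r, ip V f (φ i) * (g x * φ i x) := fun x => by
    simp only [proj, Finset.mul_sum]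
    exact Finset.sum_congr rfl fun i _ => by ring
  unfold ip
  simp_rw [h1]
  have hI : ∀ i, Integrable (fun x => g x * φ i x) (gibbs V) := fun i => hg.integrable_mul (hφ i)
  rw [integral_finsetSum _ fun i _ => (hI i).const_mul _]
  simp only [integral_const_mul]
  rfl

/-- Pythagoras: orthonormality gives `‖Π_r f‖² = ⟨f, Π_r f⟩_π`. This turns the tail bound into a
lower bound on `⟨f, Π_r f⟩_π`. -/
theorem ip_sub_proj_self {φ : ℕ → Sp d → ℝ} (hφ : ∀ i, MemLp (φ i) 2 (gibbs V))
    (horth : ∀ i j, ip V (φ i) (φ j) = if i = j then 1 else 0) (r : ℕ)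
    {f : Sp d → ℝ} (hf : MemLp f 2 (gibbs V)) :
    ip V (fun x => f x - proj V φ r f x) (fun x => f x - proj V φ r f x) =
      ip V f f - ip V f (proj V φ r f) := by
  have hp := memLp_proj hφ r f
  have hfp : MemLp (fun x => f x - proj V φ r f x) 2 (gibbs V) := hf.sub hp
  have hpφ : ∀ i ∈ Finset.Icc 1 r, ip V (proj V φ r f) (φ i) = ip V f (φ i) := fun i hi => by
    rw [ip_comm, ip_proj hφ r f (hφ i)]
    simp [horth, hi]
  have hpp : ip V (proj V φ r f) (proj V φ r f) = ip V f (proj V φ r f) := by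
    rw [ip_proj hφ r f hp, ip_proj hφ r f hf]
    exact Finset.sum_congr rfl fun i hi => by rw [hpφ i hi]
  rw [ip_sub_right hfp hf hp, ip_comm _ f, ip_comm _ (proj V φ r f), ip_sub_right hf hf hp,
    ip_sub_right hp hf hp, hpp, ip_comm (proj V φ r f) f]
  ring

theorem integral_norm_sq_le_of_eLpNorm_le {E : Type*} [NormedAddCommGroup E] {α : Type*}
    [MeasurableSpace α] {μ : Measure α} {f : α → E} (hf : AEStronglyMeasurable f μ) {b : ℝ}
    (hb : 0 ≤ b) (hle : eLpNorm f 2 μ ≤ ENNReal.ofReal b) : ∫ x, ‖f x‖ ^ 2 ∂μ ≤ b ^ 2 := by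
  have hm : MemLp f 2 μ := ⟨hf, hle.trans_lt ENNReal.ofReal_lt_top⟩
  rw [hm.eLpNorm_eq_integral_rpow_norm (by norm_num) (by norm_num)] at hle
  simp only [ENNReal.toReal_ofNat, Real.rpow_ofNat] at hle
  rw [ENNReal.ofReal_le_ofReal_iff hb, ← one_div, ← Real.sqrt_eq_rpow] at hle
  exact (Real.sqrt_le_left hb).mp hle

variable {r : ℕ} {lamh : Fin r → ℝ} {φh : Fin r → Sp d → ℝ} {μ : Measure (Sp d)}

/-- The density and its fluctuation differ by a constant, which is orthogonal to the mean-zero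
`φ̂_i`. -/
theorem khat_density_eq (hV : IsPotential L V) (hφ : IsApproxEigenpairs V lamh φh)
    (hf : MemLp (fluct V μ) 2 (gibbs V)) :
    Khat V lamh φh (density V μ) = Khat V lamh φh (fluct V μ) := by
  have := hV.isProbabilityMeasure
  ext x
  unfold Khat
  refine Finset.sum_congr rfl fun i _ => ?_
  congr 2
  have hφi := (hφ.inDomain i).memLp
  have h1 : ∀ x, density V μ x * φh i x = fluct V μ x * φh i x + φh i x := fun x => by
    simp only [fluct]; ring
  have hI : Integrable (fun x => fluct V μ x * φh i x) (gibbs V) := hf.integrable_mul hφi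
  simp only [ip, h1]
  rw [integral_add hI (hφi.integrable (by norm_num)), hφ.mean_zero i, add_zero]

/-- Dissipation estimate: moving the integral to `π` leaves `⟨f, ℒg⟩_π`, which splits into a
projection part (Pythagoras and the tail bound) and the operator error. -/
theorem le_integral_langevin_khat (hV : IsPotential L V) {lam : ℕ → ℝ} {φ : ℕ → Sp d → ℝ}
    (hφ : IsEigenbasis V lam φ) (hφh : IsApproxEigenpairs V lamh φh) {ε η B : ℝ} (hη : 0 ≤ η)
    [IsProbabilityMeasure μ] (hμ : Conditions V φ lamh φh ε η B μ) :
    Integrable (langevin V (Khat V lamh φh (density V μ))) μ ∧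
    (1 - ε) * ip V (fluct V μ) (fluct V μ) - η ^ 2 ≤
      ∫ x, langevin V (Khat V lamh φh (density V μ)) x ∂μ := by
  have := hV.isProbabilityMeasure
  have hdom := InDomain.khat (lamh := lamh) hφh.inDomain (density V μ)
  set g := Khat V lamh φh (density V μ) with hg
  have hf := hμ.memLp
  have hl := hdom.langevin_memLp
  have hφL : ∀ i, MemLp (φ i) 2 (gibbs V) := fun i => (hφ.inDomain i).memLp
  have hp := memLp_proj hφL r (fluct V μ)
  have hI1 : Integrable (fun x => fluct V μ x * langevin V g x) (gibbs V) := hf.integrable_mul hl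
  have hI2 : Integrable (langevin V g) (gibbs V) := hl.integrable (by norm_num)
  have heq : ∀ x, (μ.rnDeriv (gibbs V) x).toReal • langevin V g x =
      fluct V μ x * langevin V g x + langevin V g x := fun x => by
    simp only [fluct, density, smul_eq_mul]; ring
  have hσ : SigmaFinite (gibbs V) := inferInstance
  have hs : SFinite μ := inferInstance
  have hdecomp : μ.HaveLebesgueDecomposition (gibbs V) := inferInstance
  refine ⟨?_, ?_⟩
  · rw [← integrable_rnDeriv_smul_iff hμ.absCont]
    simp_rw [heq]
    exact hI1.add hI2
  · rw [← integral_rnDeriv_smul hμ.absCont]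
    simp_rw [heq]
    rw [integral_add hI1 hI2, integral_langevin_eq_zero hV hdom, add_zero]
    have h1 : ip V (fluct V μ) (specErr V φ lamh φh (fluct V μ)) =
        ip V (fluct V μ) (langevin V g) - ip V (fluct V μ) (proj V φ r (fluct V μ)) := by
      rw [← ip_sub_right hf hl hp, hg, khat_density_eq hV hφh hf]
      rfl
    have h2 := (abs_le.mp hμ.approx).1
    have h3 := integral_norm_sq_le_of_eLpNorm_le (hf.sub hp).aestronglyMeasurable hη hμ.tail
    have h4 := ip_sub_proj_self hφL hφ.orthonormal r hf
    have h5 : ∫ x, ‖(fluct V μ - proj V φ r (fluct V μ)) x‖ ^ 2 ∂(gibbs V) =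
        ip V (fun x => fluct V μ x - proj V φ r (fluct V μ) x)
          (fun x => fluct V μ x - proj V φ r (fluct V μ) x) := by
      simp only [ip, Pi.sub_apply, Real.norm_eq_abs, sq, abs_mul_abs_self]
    rw [h5, h4] at h3
    change _ ≤ ip V (fluct V μ) (langevin V g)
    linarith

theorem Conditions.memLp_density (hV : IsPotential L V) {φ : ℕ → Sp d → ℝ} {ε η B : ℝ}
    (hμ : Conditions V φ lamh φh ε η B μ) :
    MemLp (fun x => (μ.rnDeriv (gibbs V) x).toReal) 2 (gibbs V) := by
  have := hV.isProbabilityMeasure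
  have h := hμ.memLp.add (memLp_const (1 : ℝ))
  refine h.congr_norm ?_ (ae_of_all _ fun x => ?_)
  · exact (Measure.measurable_rnDeriv _ _).ennreal_toReal.aestronglyMeasurable
  · simp [fluct, density]

theorem contDiff_velocity (hφh : IsApproxEigenpairs V lamh φh) :
    ContDiff ℝ 1 (velocity V lamh φh μ) :=
  contDiff_gradient (InDomain.khat hφh.inDomain _).contDiff

theorem kl_ne_top (hV : IsPotential L V) {φ : ℕ → Sp d → ℝ} {ε η B : ℝ}
    [IsProbabilityMeasure μ] (hμ : Conditions V φ lamh φh ε η B μ) : kl V μ ≠ ⊤ := by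
  have := hV.isProbabilityMeasure
  exact klDiv_ne_top hμ.absCont (integrable_llr_of_memLp hμ.absCont (hμ.memLp_density hV))

theorem toReal_kl_map_velocity_le (hV : IsPotential L V) {lam : ℕ → ℝ} {φ : ℕ → Sp d → ℝ}
    (hφ : IsEigenbasis V lam φ) (hφh : IsApproxEigenpairs V lamh φh) {ε η B h : ℝ} (hη : 0 ≤ η)
    (hε : ε ≤ 1) (hh : 0 ≤ h) (hhB : h * B ≤ 1 / 2)
    [IsProbabilityMeasure μ] (hμ : Conditions V φ lamh φh ε η B μ)
    (hν : kl V (μ.map fun x => x - h • velocity V lamh φh μ x) ≠ ⊤) :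
    (kl V (μ.map fun x => x - h • velocity V lamh φh μ x)).toReal ≤
      (1 - (1 - ε) * h) * (kl V μ).toReal + h * η ^ 2 +
        (|L| / 2 * B ^ 2 + d * (2 * B ^ 2)) * h ^ 2 := by
  have := hV.isProbabilityMeasure
  have hg := (InDomain.khat (lamh := lamh) hφh.inDomain (density V μ)).contDiff
  obtain ⟨hlI, hl⟩ := le_integral_langevin_khat hV hφ hφh hη hμ
  set g := Khat V lamh φh (density V μ)
  set v := velocity V lamh φh μ
  have hvg : v = gradient g := rfl
  have hv : ContDiff ℝ 1 v := contDiff_velocity hφh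
  have hvd : Differentiable ℝ v := hv.differentiable (by norm_num)
  have hB : 0 ≤ B := (norm_nonneg _).trans (hμ.fderiv_velocity_le 0)
  have hvm : MemLp v 2 μ := ⟨hv.continuous.aestronglyMeasurable,
    hμ.velocity_le.trans_lt ENNReal.ofReal_lt_top⟩
  have hv2 : ∫ x, ‖v x‖ ^ 2 ∂μ ≤ B ^ 2 :=
    integral_norm_sq_le_of_eLpNorm_le hv.continuous.aestronglyMeasurable hB hμ.velocity_le
  have hnorm : ∀ x, ‖h • fderiv ℝ v x‖ ≤ h * B := fun x => by
    rw [norm_smul, Real.norm_of_nonneg hh]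
    exact mul_le_mul_of_nonneg_left (hμ.fderiv_velocity_le x) hh
  have hsymm : ∀ x, ((h • fderiv ℝ v x : Sp d →L[ℝ] Sp d) : Sp d →ₗ[ℝ] Sp d).IsSymmetric :=
    fun x => by
      rw [ContinuousLinearMap.toLinearMap_smul]
      exact (isSymmetric_fderiv_gradient hg x).smul (by simp)
  have hdet := fun x => det_one_sub_pos_and_neg_log_det_le (hsymm x) ((hnorm x).trans hhB)
  have hT : ∀ x, HasFDerivAt (fun x => x - h • v x)
      (ContinuousLinearMap.id ℝ (Sp d) - h • fderiv ℝ v x) x := fun x =>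
    (hasFDerivAt_id x).sub ((hvd x).hasFDerivAt.const_smul h)
  have hT' : Continuous fun x => ContinuousLinearMap.id ℝ (Sp d) - h • fderiv ℝ v x :=
    continuous_const.sub ((hv.continuous_fderiv (by norm_num)).const_smul h)
  -- `h v` is Lipschitz with constant `hB ≤ 1/2`, so `I - h v` cannot identify two points.
  have hinj : Function.Injective fun x => x - h • v x := by
    intro x y hxy
    have h1 : ‖v x - v y‖ ≤ B * ‖x - y‖ :=
      convex_univ.norm_image_sub_le_of_norm_fderiv_le (fun z _ => hvd z)
        (fun z _ => hμ.fderiv_velocity_le z) (Set.mem_univ y) (Set.mem_univ x)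
    have h2 : x - y = h • (v x - v y) := by
      rw [smul_sub, sub_eq_sub_iff_add_eq_add]
      simp only at hxy
      rw [sub_eq_sub_iff_add_eq_add] at hxy
      rw [hxy, add_comm]
    have h3 : ‖x - y‖ ≤ 1 / 2 * ‖x - y‖ := by
      conv_lhs => rw [h2]
      rw [norm_smul, Real.norm_of_nonneg hh]
      calc h * ‖v x - v y‖ ≤ h * (B * ‖x - y‖) := mul_le_mul_of_nonneg_left h1 hh
        _ = h * B * ‖x - y‖ := by ring
        _ ≤ _ := mul_le_mul_of_nonneg_right hhB (norm_nonneg _)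
    have h4 : ‖x - y‖ = 0 := by linarith [norm_nonneg (x - y)]
    exact sub_eq_zero.mp (norm_eq_zero.mp h4)
  -- `-h⟨∇V, ∇g⟩` from the expansion of `V` and `h Δg` from the log-determinant combine into `-h
  -- ℒg`; the rest is second order in `h`.
  set b : Sp d → ℝ := fun x => -h * langevin V g x +
    (|L| / 2 * h ^ 2 * ‖v x‖ ^ 2 + d * (2 * (h * B) ^ 2)) with hb
  have hI1 : Integrable (fun x => -h * langevin V g x) μ := hlI.const_mul _
  have hI2 : Integrable (fun x => |L| / 2 * h ^ 2 * ‖v x‖ ^ 2) μ :=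
    ((memLp_two_iff_integrable_sq_norm hvm.aestronglyMeasurable).mp hvm).const_mul _
  have hI3 : Integrable (fun _ : Sp d => (d : ℝ) * (2 * (h * B) ^ 2)) μ := integrable_const _
  have hle : ∀ x, V (x - h • v x) - V x -
      Real.log (ContinuousLinearMap.id ℝ (Sp d) - h • fderiv ℝ v x).det ≤ b x := fun x => by
    have h1 := le_quadratic_of_hessian_le hV.contDiff hV.hessian_le x (-(h • v x))
    rw [← sub_eq_add_neg, norm_neg, norm_smul, Real.norm_of_nonneg hh, inner_neg_right,
      inner_smul_right] at h1
    have h2 := (hdet x).2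
    have h3 : LinearMap.trace ℝ (Sp d) (h • fderiv ℝ v x : Sp d →L[ℝ] Sp d) =
        h * Laplacian.laplacian g x := by
      rw [laplacian_eq_trace hg, ContinuousLinearMap.toLinearMap_smul, map_smul]
      rfl
    rw [h3, finrank_euclideanSpace_fin] at h2
    have h4 : ‖h • fderiv ℝ v x‖ ^ 2 ≤ (h * B) ^ 2 :=
      pow_le_pow_left₀ (norm_nonneg _) (hnorm x) 2
    have h5 : (d : ℝ) * (2 * ‖h • fderiv ℝ v x‖ ^ 2) ≤ d * (2 * (h * B) ^ 2) :=
      mul_le_mul_of_nonneg_left (by linarith) (Nat.cast_nonneg d)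
    -- `L` may be negative, while only an upper bound on `∫ ‖v‖² dμ` is available.
    have h6 : L / 2 * (h * ‖v x‖) ^ 2 ≤ |L| / 2 * (h * ‖v x‖) ^ 2 :=
      mul_le_mul_of_nonneg_right (by linarith [le_abs_self L]) (sq_nonneg _)
    simp only [hb, langevin, ← hvg]
    linarith
  have hmain := toReal_klDiv_map_le hV.contDiff.continuous.measurable hT hT' hinj
    (fun x => (hdet x).1) (kl_ne_top hV hμ) hν (hI1.add (hI2.add hI3)) hle
  have hint : ∫ x, b x ∂μ = -h * ∫ x, langevin V g x ∂μ +
      (|L| / 2 * h ^ 2 * ∫ x, ‖v x‖ ^ 2 ∂μ + d * (2 * (h * B) ^ 2)) := by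
    have hI4 : Integrable (fun x => |L| / 2 * h ^ 2 * ‖v x‖ ^ 2 + d * (2 * (h * B) ^ 2)) μ :=
      hI2.add hI3
    rw [hb, integral_add hI1 hI4, integral_add hI2 hI3, integral_const_mul, integral_const_mul]
    simp
  have hchi : (kl V μ).toReal ≤ ip V (fluct V μ) (fluct V μ) :=
    toReal_klDiv_le_integral_sq hμ.absCont (hμ.memLp_density hV)
  have h1 : (1 - ε) * (kl V μ).toReal - η ^ 2 ≤ ∫ x, langevin V g x ∂μ :=
    le_trans (sub_le_sub_right (mul_le_mul_of_nonneg_left hchi (by linarith)) _) hl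
  have h2 := mul_le_mul_of_nonneg_left h1 hh
  have h3 := mul_le_mul_of_nonneg_left hv2 (by positivity : 0 ≤ |L| / 2 * h ^ 2)
  change _ ≤ _ + ∫ x, b x ∂μ at hmain
  rw [hint] at hmain
  refine hmain.trans ?_
  change (kl V μ).toReal + _ ≤ _
  linarith

theorem isProbabilityMeasure_iter (hφh : IsApproxEigenpairs V lamh φh) (h : ℝ) (μ₀ : Measure (Sp d))
    [IsProbabilityMeasure μ₀] (t : ℕ) : IsProbabilityMeasure (iter V lamh φh h μ₀ t) := by
  induction t with
  | zero => assumption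
  | succ t ih =>
    exact Measure.isProbabilityMeasure_map (continuous_id.sub
      ((contDiff_velocity hφh).continuous.const_smul h)).measurable.aemeasurable

end Step

/-! ### Iterating the one-step bound -/

theorem le_pow_mul_add_of_le_mul_add {u : ℕ → ℝ} {q s c : ℝ} (hq : 0 ≤ q)
    (hc : q * c + s ≤ c) (hc0 : 0 ≤ c) (hu : ∀ t, u (t + 1) ≤ q * u t + s) (T : ℕ) :
    u T ≤ q ^ T * u 0 + c := by
  induction T with
  | zero => simpa using hc0
  | succ T ih =>
    calc u (T + 1) ≤ q * u T + s := hu T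
      _ ≤ q * (q ^ T * u 0 + c) + s := by gcongr
      _ = q ^ (T + 1) * u 0 + (q * c + s) := by ring
      _ ≤ _ := by gcongr

end KSWGD

theorem mainTheorem3 (d : ℕ) (L B : ℝ) :
    ∃ C h₀ : ℝ, 0 ≤ C ∧ 0 < h₀ ∧
      ∀ (V : KSWGD.Sp d → ℝ), KSWGD.IsPotential L V →
      ∀ (lam : ℕ → ℝ) (φ : ℕ → KSWGD.Sp d → ℝ), KSWGD.IsEigenbasis V lam φ →
      ∀ (r : ℕ) (lamh : Fin r → ℝ) (φh : Fin r → KSWGD.Sp d → ℝ),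
        KSWGD.IsApproxEigenpairs V lamh φh →
      ∀ (ε η α β : ℝ), 0 < ε → ε < 1 → 0 < η → α = 1 - ε → β = η ^ 2 →
      ∀ (h : ℝ), 0 < h → h ≤ h₀ →
      ∀ (μ₀ : MeasureTheory.Measure (KSWGD.Sp d)), MeasureTheory.IsProbabilityMeasure μ₀ →
        (∀ t : ℕ, KSWGD.Conditions V φ lamh φh ε η B (KSWGD.iter V lamh φh h μ₀ t)) →
        (∀ t : ℕ, KSWGD.kl V (KSWGD.iter V lamh φh h μ₀ t) ≠ ⊤) ∧
        (∀ t : ℕ, (KSWGD.kl V (KSWGD.iter V lamh φh h μ₀ (t + 1))).toReal ≤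
          (1 - α * h) * (KSWGD.kl V (KSWGD.iter V lamh φh h μ₀ t)).toReal
            + h * β + C * h ^ 2) ∧
        (∀ T : ℕ, (KSWGD.kl V (KSWGD.iter V lamh φh h μ₀ T)).toReal ≤
          (1 - α * h) ^ T * (KSWGD.kl V μ₀).toReal + β / α + C / α * h) := by
  -- The two terms of `C` come from the Taylor remainder of `V` and from the log-determinant. The
  -- choice of `h₀` gives `hB ≤ 1/2`; the `+ 1` also gives `h ≤ 1/2`.
  refine ⟨|L| / 2 * B ^ 2 + d * (2 * B ^ 2), 1 / (2 * (|B| + 1)), by positivity, by positivity, ?_⟩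
  intro V hV lam φ hφ r lamh φh hφh ε η α β hε hε1 hη hα hβ h hh hh0 μ₀ hμ₀ hcond
  subst hα hβ
  have hprob := KSWGD.isProbabilityMeasure_iter hφh h μ₀
  have htop : ∀ t, KSWGD.kl V (KSWGD.iter V lamh φh h μ₀ t) ≠ ⊤ := fun t =>
    KSWGD.kl_ne_top hV (hcond t)
  rw [le_div_iff₀ (by positivity)] at hh0
  have hhB0 : 0 ≤ h * |B| := by positivity
  have hhB : h * B ≤ 1 / 2 := by
    have := mul_le_mul_of_nonneg_left (le_abs_self B) hh.le
    linarith
  have hstep := fun t => KSWGD.toReal_kl_map_velocity_le hV hφ hφh hη.le hε1.le hh.le hhB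
    (hcond t) (htop (t + 1))
  refine ⟨htop, hstep, fun T => ?_⟩
  set C := |L| / 2 * B ^ 2 + d * (2 * B ^ 2) with hC
  have hC0 : 0 ≤ C := by positivity
  have hα : 0 < 1 - ε := by linarith
  -- Uses `h ≤ 1/2` and `0 < 1 - ε < 1`.
  have hq : 0 ≤ 1 - (1 - ε) * h := by nlinarith
  rw [add_assoc]
  -- `c = β/α + (C/α)h` is the exact fixed point of `c ↦ (1 - αh)c + hβ + Ch²`, hence the equality.
  refine KSWGD.le_pow_mul_add_of_le_mul_add
    (u := fun t => (KSWGD.kl V (KSWGD.iter V lamh φh h μ₀ t)).toReal)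
    (s := h * η ^ 2 + C * h ^ 2) hq (le_of_eq ?_) (by positivity)
    (fun t => (hstep t).trans_eq (add_assoc _ _ _)) T
  field_simp
  ring
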